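/- Let $\Omega=\{(t_1,t_2)\in\mathbb{R}^2 : t_2>t_1\}$ and $\partial\Omega=\{(t,t):t\in\mathbb{R}\}$, put $\overline\Omega=\Omega\cup\partial\Omega$, and let $d$ be the Euclidean distance. Let $1\le p<\infty$. Let $\mathcal{M}^p$ be the set of Radon measures $\mu$ on $\Omega$ (Borel measures giving finite mass to every compact subset of $\Omega$) such that $\int_\Omega d(x,\partial\Omega)^p\,\mathrm{d}\mu(x)<\infty$. For $\mu,\nu\in\mathcal{M}^p$, let $\mathrm{Adm}(\mu,\nu)$ be the set of Borel measures $\pi$ on $\overline\Omega\times\overline\Omega$ that give finite mass to every compact subset of $E_\Omega=(\overline\Omega\times\overline\Omega)\setminus(\partial\Omega\times\partial\Omega)$ and satisfy $\pi(A\times\overline\Omega)=\mu(A)$ and $\pi(\overline\Omega\times B)=\nu(B)$ for all Borel sets $A,B\subset\Omega$, and let $$\mathrm{OT}_p(\mu,\nu)=\Big(\inf_{\pi\in\mathrm{Adm}(\mu,\nu)}\iint_{\overline\Omega\times\overline\Omega}d(x,y)^p\,\mathrm{d}\pi(x,y)\Big)^{1/p}.$$ Then $\mathrm{OT}_p$ is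 a (finite-valued) metric on $\mathcal{M}^p$, and the metric space $(\mathcal{M}^p,\mathrm{OT}_p)$ is complete and separable; in particular it is a Polish space. -/

import Mathlib

open MeasureTheory
open scoped ENNReal

/-- The plane `ℝ²` with its Euclidean distance. -/
abbrev Plane : Type := EuclideanSpace ℝ (Fin 2)

/-- The open half-plane `Ω = {(t₁, t₂) : t₁ < t₂}`. -/
def upperDiag : Set Plane := {x | x 0 < x 1}

/-- The diagonal `∂Ω = {(t, t)}`. -/
def theDiag : Set Plane := {x | x 0 = x 1}

/-- The closed half-plane `Ω ∪ ∂Ω`. -/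
def groundSpace : Set Plane := upperDiag ∪ theDiag

/-- The inclusion of `Ω` into the closed half-plane. -/
def toGround : upperDiag → groundSpace := Set.inclusion Set.subset_union_left

/-- `E_Ω`: the pairs of points of the closed half-plane that do not both lie on the diagonal. -/
def offDiagPairs : Set (groundSpace × groundSpace) :=
  {z | ¬ ((z.1 : Plane) ∈ theDiag ∧ (z.2 : Plane) ∈ theDiag)}

/-- The persistence of order `p`: the integral over `Ω` of `d(x, ∂Ω)^p`. -/
noncomputable def persistence (p : ℝ) (μ : Measure upperDiag) : ℝ≥0∞ :=
  ∫⁻ x, (Metric.infEDist (x : Plane) theDiag) ^ p ∂μ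

/-- `M^p`: the Radon measures on `Ω` (Borel measures, finite on the compact subsets of `Ω`)
with finite persistence of order `p`. -/
def persistenceMeasures (p : ℝ) : Set (Measure upperDiag) :=
  {μ | IsFiniteMeasureOnCompacts μ ∧ persistence p μ < ∞}

/-- The admissible plans between `μ` and `ν`: Borel measures on the square of the closed
half-plane, Radon on `E_Ω`, with `π(A × Ω̄) = μ(A)` and `π(Ω̄ × B) = ν(B)` for all Borel
subsets `A`, `B` of `Ω`. Nothing is required of the mass of pairs of diagonal points. -/
def admissiblePlans (μ ν : Measure upperDiag) : Set (Measure (groundSpace × groundSpace)) :=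
  {π | (∀ K : Set (groundSpace × groundSpace), IsCompact K → K ⊆ offDiagPairs → π K < ∞) ∧
    (∀ A : Set upperDiag, MeasurableSet A → π ((toGround '' A) ×ˢ Set.univ) = μ A) ∧
    (∀ B : Set upperDiag, MeasurableSet B → π (Set.univ ×ˢ (toGround '' B)) = ν B)}

/-- The cost of a plan: the integral of `d(x, y)^p`. -/
noncomputable def planCost (p : ℝ) (π : Measure (groundSpace × groundSpace)) : ℝ≥0∞ :=
  ∫⁻ z, (edist z.1 z.2) ^ p ∂π

/-- `OT_p(μ, ν)`, with values in `[0, ∞]`. -/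
noncomputable def OT (p : ℝ) (μ ν : Measure upperDiag) : ℝ≥0∞ :=
  (⨅ π ∈ admissiblePlans μ ν, planCost p π) ^ (1 / p)

open ProbabilityTheory Filter Topology Set

/-! A plan is treated as a pair of random points of the closed half-plane, defined on a measure
space of possibly infinite mass, whose laws on `Ω` are the two given measures (`Represents`). Every
such pair bounds `OT` by its `L^p` distance (`OT_le_of_represents`).

The main tool is gluing: a whole sequence of plans is realized on one space of trajectories
(`exists_trajectory_measure`, `exists_realization`). Ordinary gluing is not available, because on
the diagonal the marginals of consecutive plans need neither agree nor be σ-finite. So a point that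
reaches the diagonal is frozen there, and the mass that a plan takes out of the diagonal starts a
new family of trajectories. Freezing costs nothing, since `d(x, x) = 0`.

The triangle inequality is then Minkowski's inequality. For completeness, a rapidly Cauchy sequence
becomes a sequence of random points that is Cauchy in `L^p`; it converges almost everywhere, and the
law of the limit in `Ω` is the limit sought. Definiteness comes from Markov's inequality and
regularity of Radon measures. For separability, a measure is moved onto a dense sequence with
displacement proportional to the distance to the diagonal; its masses are then lowered to finitely
many rational ones, the surplus being sent to the diagonal. -/

/-! ### Disintegration over a σ-finite first marginal. -/

/-- A positive integrable weight `w` in the first coordinate makes the measure finite. Reweighting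
fibres does not change the conditional laws, so the kernel of the finite measure serves. -/
theorem exists_markovKernel_lintegral_eq {α β : Type*} [MeasurableSpace α] [MeasurableSpace β]
    [StandardBorelSpace β] [Nonempty β] (ρ : Measure (α × β)) [SigmaFinite ρ.fst] :
    ∃ κ : Kernel α β, IsMarkovKernel κ ∧ ∀ F : α × β → ℝ≥0∞, Measurable F →
      ∫⁻ z, F z ∂ρ = ∫⁻ x, ∫⁻ y, F (x, y) ∂κ x ∂ρ.fst := by
  obtain ⟨g, hg0, hgm, hgi⟩ := exists_pos_lintegral_lt_of_sigmaFinite ρ.fst one_ne_zero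
  set w : α → ℝ≥0∞ := fun x => g x with hw
  have hwm : Measurable w := by fun_prop
  have hw0 : ∀ x, w x ≠ 0 := fun x => by simpa [hw] using (hg0 x).ne'
  have hwt : ∀ x, w x ≠ ∞ := fun x => by simp [hw]
  set ρ' := ρ.withDensity (fun z => w z.1) with hρ'
  have hwm1 : Measurable fun z : α × β => w z.1 := by fun_prop
  have hfst : ∀ f : α → ℝ≥0∞, Measurable f → ∫⁻ x, f x ∂ρ.fst = ∫⁻ z, f z.1 ∂ρ := fun f hf => by
    rw [Measure.fst, lintegral_map hf measurable_fst]
  have hfin : IsFiniteMeasure ρ' := by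
    refine ⟨?_⟩
    rw [hρ', withDensity_apply _ MeasurableSet.univ, Measure.restrict_univ, ← hfst w hwm]
    exact hgi.trans ENNReal.one_lt_top
  refine ⟨ρ'.condKernel, inferInstance, fun F hF => ?_⟩
  have key : ∫⁻ z, (w z.1)⁻¹ * F z ∂ρ' =
      ∫⁻ x, ∫⁻ y, (w x)⁻¹ * F (x, y) ∂ρ'.condKernel x ∂ρ'.fst := by
    rw [← Measure.lintegral_condKernel]
    fun_prop
  have hdens : ∀ f : α × β → ℝ≥0∞, Measurable f → ∫⁻ z, f z ∂ρ' = ∫⁻ z, w z.1 * f z ∂ρ :=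
    fun f hf => lintegral_withDensity_eq_lintegral_mul _ hwm1 hf
  have h1 : ∫⁻ z, (w z.1)⁻¹ * F z ∂ρ' = ∫⁻ z, F z ∂ρ := by
    rw [hdens _ (by fun_prop)]
    refine lintegral_congr fun z => ?_
    rw [← mul_assoc, ENNReal.mul_inv_cancel (hw0 _) (hwt _), one_mul]
  have hm : Measurable fun x => ∫⁻ y, F (x, y) ∂ρ'.condKernel x :=
    Measurable.lintegral_kernel_prod_right' hF
  have h2 : ∫⁻ x, ∫⁻ y, (w x)⁻¹ * F (x, y) ∂ρ'.condKernel x ∂ρ'.fst =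
      ∫⁻ x, ∫⁻ y, F (x, y) ∂ρ'.condKernel x ∂ρ.fst := by
    have : ∀ x, ∫⁻ y, (w x)⁻¹ * F (x, y) ∂ρ'.condKernel x =
        (w x)⁻¹ * ∫⁻ y, F (x, y) ∂ρ'.condKernel x := fun x =>
      lintegral_const_mul _ (by fun_prop)
    simp_rw [this]
    have hm1 : Measurable fun z : α × β => (w z.1)⁻¹ * ∫⁻ y, F (z.1, y) ∂ρ'.condKernel z.1 :=
      hwm1.inv.mul (hm.comp measurable_fst)
    rw [Measure.fst, lintegral_map (by fun_prop) measurable_fst, hdens _ hm1, hfst _ hm]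
    refine lintegral_congr fun z => ?_
    rw [← mul_assoc, ENNReal.mul_inv_cancel (hw0 _) (hwt _), one_mul]
  rw [← h1, key, h2]

/-! ### Markov chains with prescribed kernels. -/

section Chain

variable {G : Type*} [MeasurableSpace G]

/-- The transition kernels of a Markov chain, as kernels on histories. -/
noncomputable def historyKernel (κ : ℕ → Kernel G G) (n : ℕ) :
    Kernel (∀ _ : Finset.Iic n, G) G :=
  (κ n).comap (fun h => h ⟨n, Finset.mem_Iic.2 le_rfl⟩) (measurable_pi_apply _)

instance (κ : ℕ → Kernel G G) [∀ n, IsMarkovKernel (κ n)] (n : ℕ) :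
    IsMarkovKernel (historyKernel κ n) := by
  unfold historyKernel; infer_instance

theorem traj_self_ae [MeasurableSingletonClass G] (κ : ℕ → Kernel G G)
    [∀ n, IsMarkovKernel (κ n)] (n : ℕ) (h : ∀ _ : Finset.Iic n, G) :
    ∀ᵐ w ∂(Kernel.traj (X := fun _ => G) (historyKernel κ) n h), ∀ i : Finset.Iic n, w i = h i := by
  have h1 := Kernel.traj_map_frestrictLe_apply (X := fun _ => G) (κ := historyKernel κ) n n h
  rw [Kernel.partialTraj_self, Kernel.id_apply] at h1
  have h2 : ∀ᵐ v ∂(Measure.dirac h), v = h := by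
    rw [ae_dirac_eq]; rfl
  rw [← h1] at h2
  filter_upwards [ae_of_ae_map (by fun_prop) h2] with w hw i
  rw [← hw]; rfl

/-- The Markov property of a chain. -/
theorem lintegral_traj_succ [MeasurableSingletonClass G] (κ : ℕ → Kernel G G)
    [∀ n, IsMarkovKernel (κ n)] {k n : ℕ} (hkn : k ≤ n) (h : ∀ _ : Finset.Iic k, G)
    {F : G × G → ℝ≥0∞} (hF : Measurable F) :
    ∫⁻ w, F (w n, w (n + 1)) ∂(Kernel.traj (X := fun _ => G) (historyKernel κ) k h) =
      ∫⁻ w, ∫⁻ y, F (w n, y) ∂κ n (w n)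
        ∂(Kernel.traj (X := fun _ => G) (historyKernel κ) k h) := by
  have hg : Measurable fun x => ∫⁻ y, F (x, y) ∂κ n x :=
    Measurable.lintegral_kernel_prod_right' hF
  have inner : ∀ h' : (∀ _ : Finset.Iic n, G),
      ∫⁻ w, F (w n, w (n + 1)) ∂(Kernel.traj (X := fun _ => G) (historyKernel κ) n h') =
      ∫⁻ y, F (h' ⟨n, Finset.mem_Iic.2 le_rfl⟩, y) ∂κ n (h' ⟨n, Finset.mem_Iic.2 le_rfl⟩) := by
    intro h'
    have h3 : (Kernel.traj (X := fun _ => G) (historyKernel κ) n h').map (fun w => w (n + 1)) =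
        κ n (h' ⟨n, Finset.mem_Iic.2 le_rfl⟩) := by
      rw [← Kernel.map_apply _ (by fun_prop), Kernel.map_traj_succ_self]
      rfl
    rw [← h3, lintegral_map (by fun_prop) (by fun_prop)]
    refine lintegral_congr_ae ?_
    filter_upwards [traj_self_ae κ n h'] with w hw
    rw [← hw ⟨n, Finset.mem_Iic.2 le_rfl⟩]
  -- Condition on the history up to time `n`, to which `inner` applies.
  conv_lhs => rw [← Kernel.traj_comp_partialTraj (X := fun _ => G) hkn]
  rw [Kernel.lintegral_comp _ _ _ (by fun_prop)]
  simp_rw [inner]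
  have hgn : Measurable fun h' : (∀ _ : Finset.Iic n, G) =>
      ∫⁻ y, F (h' ⟨n, Finset.mem_Iic.2 le_rfl⟩, y) ∂κ n (h' ⟨n, Finset.mem_Iic.2 le_rfl⟩) :=
    hg.comp (measurable_pi_apply (⟨n, Finset.mem_Iic.2 le_rfl⟩ : Finset.Iic n))
  rw [← Kernel.traj_map_frestrictLe_apply, lintegral_map hgn (by fun_prop)]
  rfl

end Chain

/-! ### Trajectories born at a given time. -/

section Trajectories

variable {G : Type*} [MeasurableSpace G]

/-- The history which stays at `z.1` before time `k` and is at `z.2` at time `k`. -/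
def jumpHistory (k : ℕ) (z : G × G) : ∀ _ : Finset.Iic k, G :=
  fun i => if (i : ℕ) = k then z.2 else z.1

theorem measurable_jumpHistory (k : ℕ) : Measurable (jumpHistory (G := G) k) := by
  refine measurable_pi_lambda _ fun i => ?_
  unfold jumpHistory
  split_ifs <;> fun_prop

/-- The law of the trajectories of a Markov chain which jump at time `k`, the jump having
law `b`. -/
noncomputable def jumpLaw (κ : ℕ → Kernel G G) [∀ n, IsMarkovKernel (κ n)] (k : ℕ)
    (b : Measure (G × G)) : Measure (ℕ → G) :=
  b.bind fun z => Kernel.traj (X := fun _ => G) (historyKernel κ) k (jumpHistory k z)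

variable (κ : ℕ → Kernel G G) [∀ n, IsMarkovKernel (κ n)] (k : ℕ) (b : Measure (G × G))

theorem lintegral_jumpLaw {f : (ℕ → G) → ℝ≥0∞} (hf : Measurable f) :
    ∫⁻ w, f w ∂jumpLaw κ k b = ∫⁻ z, ∫⁻ w, f w ∂Kernel.traj (X := fun _ => G)
      (historyKernel κ) k (jumpHistory k z) ∂b :=
  Measure.lintegral_bind (((Kernel.traj (X := fun _ => G) (historyKernel κ) k).measurable.comp
    (measurable_jumpHistory k)).aemeasurable) hf.aemeasurable

variable [MeasurableSingletonClass G]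

/-- Up to time `k` the trajectory is almost surely determined by the jump `z`. -/
theorem lintegral_jumpLaw_of_dependsOn {f : (ℕ → G) → ℝ≥0∞} (hf : Measurable f)
    (hdep : ∀ w w' : ℕ → G, (∀ i ≤ k, w i = w' i) → f w = f w') :
    ∫⁻ w, f w ∂jumpLaw κ k b = ∫⁻ z, f (fun i => if i = k then z.2 else z.1) ∂b := by
  rw [lintegral_jumpLaw κ k b hf]
  refine lintegral_congr fun z => ?_
  have : ∫⁻ w, f w ∂Kernel.traj (X := fun _ => G) (historyKernel κ) k (jumpHistory k z) =
      ∫⁻ _, f (fun i => if i = k then z.2 else z.1) ∂Kernel.traj (X := fun _ => G)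
        (historyKernel κ) k (jumpHistory k z) := by
    refine lintegral_congr_ae ?_
    filter_upwards [traj_self_ae κ k (jumpHistory k z)] with w hw
    refine hdep _ _ fun i hi => ?_
    rw [hw ⟨i, Finset.mem_Iic.2 hi⟩]
    rfl
  rw [this]
  simp

theorem lintegral_jumpLaw_succ {n : ℕ} (hkn : k ≤ n) {F : G × G → ℝ≥0∞} (hF : Measurable F) :
    ∫⁻ w, F (w n, w (n + 1)) ∂jumpLaw κ k b =
      ∫⁻ w, ∫⁻ y, F (w n, y) ∂κ n (w n) ∂jumpLaw κ k b := by
  have hg : Measurable fun x => ∫⁻ y, F (x, y) ∂κ n x :=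
    Measurable.lintegral_kernel_prod_right' hF
  have hgn : Measurable fun w : ℕ → G => ∫⁻ y, F (w n, y) ∂κ n (w n) :=
    hg.comp (measurable_pi_apply n)
  rw [lintegral_jumpLaw κ k b (by fun_prop), lintegral_jumpLaw κ k b hgn]
  exact lintegral_congr fun z => lintegral_traj_succ κ hkn _ hF

end Trajectories

/-! ### Gluing a sequence of plans. -/

/-- A sequence of transport plans whose consecutive marginals agree on `O` is realized by a
measure on trajectories. -/
theorem exists_trajectory_measure {G : Type*} [MeasurableSpace G] [StandardBorelSpace G]
    [Nonempty G] {O : Set G} (hO : MeasurableSet O) (m : ℕ → Measure G)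
    [∀ n, SigmaFinite (m n)] (π : ℕ → Measure (G × G))
    (hfst : ∀ n, ((π n).restrict (Prod.fst ⁻¹' O)).fst = m n)
    (hsnd : ∀ n, ((π n).restrict (Prod.snd ⁻¹' O)).snd = m (n + 1)) :
    ∃ γ : Measure (ℕ → G),
      (∀ n, ∀ f : G → ℝ≥0∞, Measurable f → (∀ x ∉ O, f x = 0) →
        ∫⁻ w, f (w n) ∂γ = ∫⁻ x, f x ∂m n) ∧
      (∀ n, ∀ F : G × G → ℝ≥0∞, Measurable F → (∀ x ∉ O, F (x, x) = 0) →
        ∫⁻ w, F (w n, w (n + 1)) ∂γ = ∫⁻ z in (Prod.fst ⁻¹' O ∪ Prod.snd ⁻¹' O), F z ∂π n) := by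
  classical
  have hO1 : MeasurableSet (Prod.fst ⁻¹' O : Set (G × G)) := measurable_fst hO
  have hO2 : MeasurableSet (Prod.snd ⁻¹' O : Set (G × G)) := measurable_snd hO
  have hsf : ∀ n, SigmaFinite ((π n).restrict (Prod.fst ⁻¹' O)).fst := fun n => by
    rw [hfst]; infer_instance
  choose κ' hκ' hκ'F using fun n =>
    exists_markovKernel_lintegral_eq ((π n).restrict (Prod.fst ⁻¹' O))
  -- In `O` the chain follows the plan; outside `O` it is frozen.
  let κ : ℕ → Kernel G G := fun n => Kernel.piecewise hO (κ' n) Kernel.id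
  have hκM : ∀ n, IsMarkovKernel (κ n) := fun n => by
    have := hκ' n
    infer_instance
  -- Family `0` carries the initial mass; family `k + 1` carries the mass that `π k` brings into `O`
  -- from outside.
  let b : ℕ → Measure (G × G) := fun k => match k with
    | 0 => (m 0).map fun x => (x, x)
    | k + 1 => (π k).restrict (Prod.snd ⁻¹' O \ Prod.fst ⁻¹' O)
  let γ : Measure (ℕ → G) := Measure.sum fun k => jumpLaw κ k (b k)
  -- Before its birth a family sits outside `O`, where `f` vanishes.
  have hdead : ∀ n k, n < k → ∀ f : G → ℝ≥0∞, Measurable f → (∀ x ∉ O, f x = 0) →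
      ∫⁻ w, f (w n) ∂jumpLaw κ k (b k) = 0 := by
    intro n k hnk f hf hf0
    obtain ⟨j, rfl⟩ := Nat.exists_eq_succ_of_ne_zero (Nat.ne_zero_of_lt hnk)
    rw [lintegral_jumpLaw_of_dependsOn κ _ _ (by fun_prop)
      fun w w' h => by rw [h n hnk.le]]
    rw [← lintegral_zero (μ := b j.succ)]
    refine setLIntegral_congr_fun (hO2.diff hO1) fun z hz => ?_
    simp only [if_neg hnk.ne]
    exact hf0 _ hz.2
  have step : ∀ n, (∀ f : G → ℝ≥0∞, Measurable f → (∀ x ∉ O, f x = 0) →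
        ∫⁻ w, f (w n) ∂γ = ∫⁻ x, f x ∂m n) →
      (∀ F : G × G → ℝ≥0∞, Measurable F → (∀ x ∉ O, F (x, x) = 0) →
        ∫⁻ w, F (w n, w (n + 1)) ∂γ =
          ∫⁻ z in (Prod.fst ⁻¹' O ∪ Prod.snd ⁻¹' O), F z ∂π n) := by
    intro n hA F hF hF0
    have hg : Measurable fun x => ∫⁻ y, F (x, y) ∂κ n x :=
      Measurable.lintegral_kernel_prod_right' hF
    set g : G → ℝ≥0∞ := fun x => ∫⁻ y, F (x, y) ∂κ n x with hgdef
    have hg0 : ∀ x ∉ O, g x = 0 := fun x hx => by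
      simp only [hgdef, κ, Kernel.piecewise_apply, if_neg hx, Kernel.id_apply]
      rw [lintegral_dirac]
      exact hF0 x hx
    -- Families already born obey the Markov property, the one born at time `n + 1` contributes its
    -- jump, and later ones rest at a point `x ∉ O`, where `F (x, x) = 0`.
    have hterm : ∀ k, ∫⁻ w, F (w n, w (n + 1)) ∂jumpLaw κ k (b k) =
        ∫⁻ w, g (w n) ∂jumpLaw κ k (b k) +
          if k = n + 1 then ∫⁻ z, F z ∂b (n + 1) else 0 := by
      intro k
      rcases lt_trichotomy k (n + 1) with h | h | h
      · rw [if_neg h.ne, add_zero]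
        exact lintegral_jumpLaw_succ κ k _ (Nat.lt_succ_iff.1 h) hF
      · subst h
        rw [hdead n _ (Nat.lt_succ_self n) g hg hg0, if_pos rfl, zero_add,
          lintegral_jumpLaw_of_dependsOn κ _ _ (by fun_prop)
          fun w w' h => by rw [h n (Nat.le_succ n), h _ le_rfl]]
        simp
      · rw [hdead n _ (by omega) g hg hg0, if_neg h.ne', zero_add]
        obtain ⟨j, rfl⟩ := Nat.exists_eq_succ_of_ne_zero (Nat.ne_zero_of_lt h)
        rw [lintegral_jumpLaw_of_dependsOn κ _ _ (by fun_prop)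
          fun w w' h' => by rw [h' n (by omega), h' (n + 1) h.le]]
        rw [← lintegral_zero (μ := b j.succ)]
        refine setLIntegral_congr_fun (hO2.diff hO1) fun z hz => ?_
        simp only [if_neg h.ne, if_neg (show n ≠ j.succ by omega)]
        exact hF0 _ hz.2
    have hgm : ∫⁻ x, g x ∂m n = ∫⁻ z in Prod.fst ⁻¹' O, F z ∂π n := by
      rw [hκ'F n F hF, ← hfst n]
      refine lintegral_congr_ae ?_
      have : ∀ᵐ x ∂((π n).restrict (Prod.fst ⁻¹' O)).fst, x ∈ O := by
        exact (ae_map_iff (p := (· ∈ O)) measurable_fst.aemeasurable hO).2 (ae_restrict_mem hO1)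
      filter_upwards [this] with x hx
      simp only [hgdef, κ, Kernel.piecewise_apply, if_pos hx]
    rw [lintegral_sum_measure]
    simp_rw [hterm]
    rw [ENNReal.tsum_add, tsum_ite_eq, ← lintegral_sum_measure, hA g hg hg0, hgm,
      ← union_sdiff_self, lintegral_union (hO2.diff hO1) disjoint_sdiff_right]
  have hA : ∀ n, ∀ f : G → ℝ≥0∞, Measurable f → (∀ x ∉ O, f x = 0) →
      ∫⁻ w, f (w n) ∂γ = ∫⁻ x, f x ∂m n := by
    intro n
    induction n with
    | zero =>
      intro f hf hf0
      rw [lintegral_sum_measure,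
        tsum_eq_single 0 fun k hk => hdead 0 k (Nat.pos_of_ne_zero hk) f hf hf0,
        lintegral_jumpLaw_of_dependsOn κ _ _ (by fun_prop) fun w w' h => by rw [h 0 le_rfl]]
      simp only [if_true, b]
      rw [lintegral_map (by fun_prop) (by fun_prop)]
    | succ n ih =>
      intro f hf hf0
      rw [step n ih (fun z => f z.2) (by fun_prop) hf0, ← hsnd n, Measure.snd,
        lintegral_map hf measurable_snd]
      rw [← lintegral_indicator (hO1.union hO2), ← lintegral_indicator hO2]
      refine lintegral_congr fun z => ?_
      by_cases hz : z.2 ∈ O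
      · rw [indicator_of_mem (show z ∈ Prod.fst ⁻¹' O ∪ Prod.snd ⁻¹' O from Or.inr hz),
          indicator_of_mem (show z ∈ Prod.snd ⁻¹' O from hz)]
      · rw [indicator_of_notMem (show z ∉ Prod.snd ⁻¹' O from hz), indicator_apply, hf0 _ hz, ite_self]
  exact ⟨γ, hA, fun n => step n (hA n)⟩

/-! ### Geometry of the half-plane. -/

theorem continuous_coord (i : Fin 2) : Continuous fun x : Plane => x i := by fun_prop

theorem isOpen_upperDiag : IsOpen upperDiag :=
  isOpen_lt (continuous_coord 0) (continuous_coord 1)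

theorem isClosed_theDiag : IsClosed theDiag :=
  isClosed_eq (continuous_coord 0) (continuous_coord 1)

theorem isClosed_groundSpace : IsClosed groundSpace := by
  have : groundSpace = {x : Plane | x 0 ≤ x 1} := by
    ext x
    exact (le_iff_lt_or_eq (a := x 0) (b := x 1)).symm
  rw [this]
  exact isClosed_le (continuous_coord 0) (continuous_coord 1)

theorem zero_mem_theDiag : (0 : Plane) ∈ theDiag := by simp [theDiag]

instance : Nonempty groundSpace := ⟨⟨0, Or.inr zero_mem_theDiag⟩⟩

instance : PolishSpace groundSpace := isClosed_groundSpace.polishSpace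

instance : LocallyCompactSpace upperDiag := isOpen_upperDiag.locallyCompactSpace

theorem range_toGround : range toGround = {x : groundSpace | (x : Plane) ∈ upperDiag} := by
  exact range_inclusion subset_union_left

theorem mem_range_toGround {x : groundSpace} :
    x ∈ range toGround ↔ (x : Plane) ∉ theDiag := by
  rw [range_toGround]
  constructor
  · exact fun h h' => ne_of_lt (show (x : Plane) 0 < (x : Plane) 1 from h) h'
  · exact fun h => x.2.resolve_right h

theorem isOpenEmbedding_toGround : IsOpenEmbedding toGround := by
  refine ⟨IsEmbedding.inclusion subset_union_left, ?_⟩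
  rw [range_toGround]
  exact isOpen_upperDiag.preimage continuous_subtype_val

theorem measurableEmbedding_toGround : MeasurableEmbedding toGround :=
  isOpenEmbedding_toGround.measurableEmbedding

/-- The distance to the diagonal. -/
noncomputable def diagDist (x : groundSpace) : ℝ≥0∞ := Metric.infEDist (x : Plane) theDiag

theorem continuous_diagDist : Continuous diagDist :=
  Metric.continuous_infEDist.comp continuous_subtype_val

@[fun_prop]
theorem measurable_diagDist : Measurable diagDist := continuous_diagDist.measurable

theorem diagDist_eq_zero {x : groundSpace} : diagDist x = 0 ↔ (x : Plane) ∈ theDiag :=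
  (Metric.mem_iff_infEDist_zero_of_closed isClosed_theDiag).symm

theorem diagDist_ne_top (x : groundSpace) : diagDist x ≠ ∞ :=
  Metric.infEDist_ne_top ⟨0, zero_mem_theDiag⟩

theorem diagDist_toGround_pos (x : upperDiag) : 0 < diagDist (toGround x) :=
  pos_iff_ne_zero.2 fun h => mem_range_toGround.1 ⟨x, rfl⟩ (diagDist_eq_zero.1 h)

theorem diagDist_le_add (x y : groundSpace) : diagDist y ≤ diagDist x + edist x y := by
  rw [edist_comm]
  exact Metric.infEDist_le_infEDist_add_edist

theorem persistence_eq (p : ℝ) (μ : Measure upperDiag) :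
    persistence p μ = ∫⁻ x, diagDist (toGround x) ^ p ∂μ := rfl

/-- The orthogonal projection to the diagonal. -/
noncomputable def diagProj (x : groundSpace) : groundSpace :=
  ⟨!₂[((x : Plane) 0 + (x : Plane) 1) / 2, ((x : Plane) 0 + (x : Plane) 1) / 2],
    Or.inr (by simp [theDiag])⟩

theorem diagProj_mem (x : groundSpace) : (diagProj x : Plane) ∈ theDiag := by
  simp [theDiag, diagProj]

theorem diagProj_notMem_range (x : groundSpace) : diagProj x ∉ range toGround := fun h =>
  mem_range_toGround.1 h (diagProj_mem x)

@[fun_prop]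
theorem measurable_diagProj : Measurable diagProj := by
  refine Measurable.subtype_mk ?_
  refine Continuous.measurable ?_
  refine (PiLp.continuous_toLp 2 _).comp (continuous_pi fun i => ?_)
  fin_cases i <;> simp <;> fun_prop

theorem edist_diagProj_le (x : groundSpace) : edist x (diagProj x) ≤ diagDist x := by
  refine Metric.le_infEDist.2 fun y hy => ?_
  rw [Subtype.edist_eq, edist_dist, edist_dist]
  refine ENNReal.ofReal_le_ofReal ?_
  rw [EuclideanSpace.dist_eq, EuclideanSpace.dist_eq]
  refine Real.sqrt_le_sqrt ?_
  have hy' : y 0 = y 1 := hy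
  simp only [Fin.sum_univ_two, Real.dist_eq, sq_abs, diagProj]
  simp only [Matrix.cons_val_zero, Matrix.cons_val_one]
  rw [← hy']
  -- The two sums of squares differ by half of this square.
  nlinarith [sq_nonneg ((x : Plane) 0 + (x : Plane) 1 - 2 * y 0)]

/-! ### Random points representing measures, and the plans they define. -/

/-- The random point `X` of the closed half-plane has law `μ` in `Ω`. -/
def Represents {S : Type*} [MeasurableSpace S] (γ : Measure S) (X : S → groundSpace)
    (μ : Measure upperDiag) : Prop :=
  ∀ A : Set upperDiag, MeasurableSet A → γ (X ⁻¹' (toGround '' A)) = μ A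

section Represents

variable {S : Type*} [MeasurableSpace S] {γ : Measure S} {X Y : S → groundSpace}
  {μ ν : Measure upperDiag}

theorem represents_iff (hX : Measurable X) :
    Represents γ X μ ↔ (γ.map X).comap toGround = μ := by
  have h : ∀ A : Set upperDiag, MeasurableSet A →
      (γ.map X).comap toGround A = γ (X ⁻¹' (toGround '' A)) := fun A hA => by
    rw [measurableEmbedding_toGround.comap_apply, Measure.map_apply hX
      (measurableEmbedding_toGround.measurableSet_image.2 hA)]
  refine ⟨fun H => Measure.ext fun A hA => (h A hA).trans (H A hA), fun H A hA => ?_⟩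
  rw [← h A hA, H]

theorem represents_comap (hX : Measurable X) :
    Represents γ X ((γ.map X).comap toGround) := (represents_iff hX).2 rfl

theorem Represents.restrict_map (hX : Measurable X) (h : Represents γ X μ) :
    (γ.map X).restrict (range toGround) = μ.map toGround := by
  rw [← (represents_iff hX).1 h, measurableEmbedding_toGround.map_comap]

theorem Represents.lintegral (hX : Measurable X) (h : Represents γ X μ) {f : groundSpace → ℝ≥0∞}
    (hf : Measurable f) (hf0 : ∀ x ∉ range toGround, f x = 0) :
    ∫⁻ s, f (X s) ∂γ = ∫⁻ x, f (toGround x) ∂μ := by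
  rw [← lintegral_map hf hX, ← lintegral_map hf measurableEmbedding_toGround.measurable,
    ← h.restrict_map hX, ← lintegral_indicator measurableEmbedding_toGround.measurableSet_range]
  refine lintegral_congr fun x => ?_
  by_cases hx : x ∈ range toGround
  · rw [indicator_of_mem hx]
  · rw [indicator_of_notMem hx, hf0 x hx]

theorem Represents.lintegral_diagDist {p : ℝ} (hp : 0 < p) (hX : Measurable X)
    (h : Represents γ X μ) : ∫⁻ s, diagDist (X s) ^ p ∂γ = persistence p μ :=
  h.lintegral hX (f := fun x => diagDist x ^ p) (by fun_prop) fun x hx => by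
    rw [mem_range_toGround, not_not] at hx
    rw [diagDist_eq_zero.2 hx, ENNReal.zero_rpow_of_pos hp]

/-- `diagDist` is 1-Lipschitz; apply Minkowski's inequality. -/
theorem persistence_rpow_le {p : ℝ} (hp : 1 ≤ p) (hX : Measurable X) (hY : Measurable Y)
    (hXμ : Represents γ X μ) (hYν : Represents γ Y ν) :
    persistence p ν ^ (1 / p) ≤
      persistence p μ ^ (1 / p) + (∫⁻ s, edist (X s) (Y s) ^ p ∂γ) ^ (1 / p) := by
  have hp0 : 0 < p := zero_lt_one.trans_le hp
  rw [← hXμ.lintegral_diagDist hp0 hX, ← hYν.lintegral_diagDist hp0 hY]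
  refine le_trans ?_ (ENNReal.lintegral_Lp_add_le (f := fun s => diagDist (X s))
    (g := fun s => edist (X s) (Y s)) (by fun_prop) (hX.edist hY).aemeasurable hp)
  gcongr with s
  exact diagDist_le_add _ _

end Represents

theorem measure_le_diagDist_lt_top {p : ℝ} (hp : 1 ≤ p) {μ : Measure upperDiag}
    (hμ : persistence p μ < ∞) {δ : ℝ≥0∞} (hδ : δ ≠ 0) (hδ' : δ ≠ ∞) :
    μ {x | δ ≤ diagDist (toGround x)} < ∞ := by
  have hp0 : 0 < p := zero_lt_one.trans_le hp
  have hm : Measurable fun x => diagDist (toGround x) ^ p :=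
    (measurable_diagDist.comp measurableEmbedding_toGround.measurable).pow_const p
  have h0 : δ ^ p ≠ 0 := (ENNReal.rpow_pos (pos_iff_ne_zero.2 hδ) hδ').ne'
  refine lt_of_le_of_lt (measure_mono fun x hx => ?_) ((meas_ge_le_lintegral_div hm.aemeasurable
    h0 (ENNReal.rpow_ne_top_of_nonneg hp0.le hδ')).trans_lt (ENNReal.div_lt_top hμ.ne h0))
  exact ENNReal.rpow_le_rpow hx hp0.le

theorem exists_le_diagDist_of_isCompact {K : Set upperDiag} (hK : IsCompact K) :
    ∃ δ : ℝ≥0∞, δ ≠ 0 ∧ δ ≠ ∞ ∧ ∀ x ∈ K, δ ≤ diagDist (toGround x) := by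
  rcases K.eq_empty_or_nonempty with rfl | hne
  · exact ⟨1, one_ne_zero, ENNReal.one_ne_top, by simp⟩
  · obtain ⟨x, -, hx⟩ := hK.exists_isMinOn hne
      (continuous_diagDist.comp isOpenEmbedding_toGround.continuous).continuousOn
    exact ⟨_, (diagDist_toGround_pos x).ne', diagDist_ne_top _, hx⟩

/-- Compact subsets of `Ω` stay away from the diagonal, so Markov's inequality makes local
finiteness automatic. -/
theorem mem_persistenceMeasures_iff {p : ℝ} (hp : 1 ≤ p) {μ : Measure upperDiag} :
    μ ∈ persistenceMeasures p ↔ persistence p μ < ∞ := by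
  refine ⟨fun h => h.2, fun h => ⟨⟨fun K hK => ?_⟩, h⟩⟩
  obtain ⟨δ, h0, ht, hδ⟩ := exists_le_diagDist_of_isCompact hK
  exact (measure_mono hδ).trans_lt (measure_le_diagDist_lt_top hp h h0 ht)

theorem sigmaFinite_of_mem {p : ℝ} {μ : Measure upperDiag} (h : μ ∈ persistenceMeasures p) :
    SigmaFinite μ := by
  have := h.1
  infer_instance

theorem OT_le_of_represents {p : ℝ} (hp : 1 ≤ p) {μ ν : Measure upperDiag}
    (hμ : persistence p μ < ∞) (hν : persistence p ν < ∞) {S : Type*} [MeasurableSpace S]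
    {γ : Measure S} {X Y : S → groundSpace} (hX : Measurable X) (hY : Measurable Y)
    (hXμ : Represents γ X μ) (hYν : Represents γ Y ν) :
    OT p μ ν ≤ (∫⁻ s, edist (X s) (Y s) ^ p ∂γ) ^ (1 / p) := by
  have hp0 : 0 < p := zero_lt_one.trans_le hp
  have himg : ∀ {A : Set upperDiag}, MeasurableSet A → MeasurableSet (toGround '' A) :=
    fun hA => measurableEmbedding_toGround.measurableSet_image.2 hA
  refine ENNReal.rpow_le_rpow ?_ (by positivity)
  set π := γ.map fun s => (X s, Y s) with hπ
  have hXY : Measurable fun s => (X s, Y s) := hX.prodMk hY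
  have h1 : ∀ A : Set upperDiag, MeasurableSet A → π ((toGround '' A) ×ˢ univ) = μ A := by
    intro A hA
    rw [hπ, Measure.map_apply hXY ((himg hA).prod MeasurableSet.univ), ← hXμ A hA]
    congr 1
    ext s
    simp
  have h2 : ∀ B : Set upperDiag, MeasurableSet B → π (univ ×ˢ (toGround '' B)) = ν B := by
    intro B hB
    rw [hπ, Measure.map_apply hXY (MeasurableSet.univ.prod (himg hB)), ← hYν B hB]
    congr 1
    ext s
    simp
  have hmem : π ∈ admissiblePlans μ ν := by
    refine ⟨fun K hK hKE => ?_, h1, h2⟩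
    rcases K.eq_empty_or_nonempty with rfl | hne
    · simp
    have hc : Continuous fun z : groundSpace × groundSpace => max (diagDist z.1) (diagDist z.2) :=
      (continuous_diagDist.comp continuous_fst).max (continuous_diagDist.comp continuous_snd)
    obtain ⟨z₀, hz₀, hmin⟩ := hK.exists_isMinOn hne hc.continuousOn
    -- Positive because `K` avoids pairs of diagonal points: every pair in `K` has a coordinate at
    -- distance at least `δ` from the diagonal, and the marginals bound the mass of such pairs.
    set δ := max (diagDist z₀.1) (diagDist z₀.2) with hδ
    have hδ0 : δ ≠ 0 := fun h => by
      have h' := max_eq_bot.1 h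
      exact hKE hz₀ ⟨diagDist_eq_zero.1 h'.1, diagDist_eq_zero.1 h'.2⟩
    have hδt : δ ≠ ∞ := by simp [hδ, diagDist_ne_top]
    set A : Set upperDiag := {x | δ ≤ diagDist (toGround x)} with hA
    have hAm : MeasurableSet A := measurableSet_le measurable_const
      (measurable_diagDist.comp measurableEmbedding_toGround.measurable)
    have hin : ∀ x : groundSpace, δ ≤ diagDist x → x ∈ toGround '' A := by
      intro x hx
      have : x ∈ range toGround := mem_range_toGround.2 fun h => by
        rw [diagDist_eq_zero.2 h] at hx
        exact hδ0 (nonpos_iff_eq_zero.1 hx)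
      obtain ⟨y, rfl⟩ := this
      exact ⟨y, hx, rfl⟩
    have hsub : K ⊆ (toGround '' A) ×ˢ univ ∪ univ ×ˢ (toGround '' A) := by
      intro z hz
      have hz' : δ ≤ max (diagDist z.1) (diagDist z.2) := hmin hz
      rcases le_max_iff.1 hz' with h | h
      · exact Or.inl ⟨hin _ h, mem_univ _⟩
      · exact Or.inr ⟨mem_univ _, hin _ h⟩
    refine ((measure_mono hsub).trans (measure_union_le _ _)).trans_lt ?_
    rw [h1 A hAm, h2 A hAm]
    exact ENNReal.add_lt_top.2 ⟨measure_le_diagDist_lt_top hp hμ hδ0 hδt,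
      measure_le_diagDist_lt_top hp hν hδ0 hδt⟩
  refine (iInf₂_le π hmem).trans_eq ?_
  rw [planCost, hπ, lintegral_map ((measurable_fst.edist measurable_snd).pow_const p) hXY]

theorem represents_fst {μ ν : Measure upperDiag} {π : Measure (groundSpace × groundSpace)}
    (h : π ∈ admissiblePlans μ ν) : Represents π Prod.fst μ := fun A hA => by
  rw [← h.2.1 A hA, prod_univ]

theorem represents_snd {μ ν : Measure upperDiag} {π : Measure (groundSpace × groundSpace)}
    (h : π ∈ admissiblePlans μ ν) : Represents π Prod.snd ν := fun A hA => by
  rw [← h.2.2 A hA, univ_prod]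

theorem exists_plan_of_OT_lt {p : ℝ} (hp : 1 ≤ p) {μ ν : Measure upperDiag} {c : ℝ≥0∞}
    (h : OT p μ ν < c) : ∃ π ∈ admissiblePlans μ ν, planCost p π ^ (1 / p) < c := by
  have hp0 : 0 < p := zero_lt_one.trans_le hp
  rw [OT, one_div, ENNReal.rpow_inv_lt_iff hp0] at h
  simp only [iInf_lt_iff] at h
  obtain ⟨π, hπ, hlt⟩ := h
  exact ⟨π, hπ, by rwa [one_div, ENNReal.rpow_inv_lt_iff hp0]⟩

/-! ### Realization of plans and the metric axioms. -/

theorem exists_realization {p : ℝ} (hp : 1 ≤ p) (μ : ℕ → Measure upperDiag)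
    (hμ : ∀ n, μ n ∈ persistenceMeasures p) (π : ℕ → Measure (groundSpace × groundSpace))
    (hπ : ∀ n, π n ∈ admissiblePlans (μ n) (μ (n + 1))) :
    ∃ γ : Measure (ℕ → groundSpace), (∀ n, Represents γ (fun w => w n) (μ n)) ∧
      ∀ n, ∫⁻ w, edist (w n) (w (n + 1)) ^ p ∂γ ≤ planCost p (π n) := by
  have hp0 : 0 < p := zero_lt_one.trans_le hp
  have hO := measurableEmbedding_toGround.measurableSet_range
  have hres : ∀ (ρ : Measure (groundSpace × groundSpace)) (f : groundSpace × groundSpace →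
      groundSpace), Measurable f → (ρ.restrict (f ⁻¹' range toGround)).map f =
        (ρ.map f).restrict (range toGround) := fun ρ f hf => (Measure.restrict_map hf hO).symm
  have hσ : ∀ n, SigmaFinite ((μ n).map toGround) := fun n => by
    have := sigmaFinite_of_mem (hμ n)
    exact measurableEmbedding_toGround.sigmaFinite_map
  obtain ⟨γ, h1, h2⟩ := exists_trajectory_measure hO (fun n => (μ n).map toGround) π
    (fun n => by
      rw [Measure.fst, hres _ _ measurable_fst,
        (represents_fst (hπ n)).restrict_map measurable_fst])
    (fun n => by
      rw [Measure.snd, hres _ _ measurable_snd,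
        (represents_snd (hπ n)).restrict_map measurable_snd])
  refine ⟨γ, fun n A hA => ?_, fun n => ?_⟩
  · have hA' := measurableEmbedding_toGround.measurableSet_image.2 hA
    have := h1 n ((toGround '' A).indicator 1) (measurable_one.indicator hA') fun x hx =>
      indicator_of_notMem (fun h => hx (image_subset_range _ _ h)) _
    rw [lintegral_indicator_one hA', measurableEmbedding_toGround.map_apply,
      preimage_image_eq _ measurableEmbedding_toGround.injective] at this
    rw [← this, ← lintegral_indicator_one (hA'.preimage (measurable_pi_apply n))]
    rfl
  · rw [h2 n (fun z => edist z.1 z.2 ^ p)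
      ((measurable_fst.edist measurable_snd).pow_const p)
      fun x _ => by simp [ENNReal.zero_rpow_of_pos hp0]]
    -- The gluing drops the mass of pairs of diagonal points, hence only an inequality.
    exact setLIntegral_le_lintegral _ _

theorem exists_realization_of_OT_lt {p : ℝ} (hp : 1 ≤ p) (μ : ℕ → Measure upperDiag)
    (hμ : ∀ n, μ n ∈ persistenceMeasures p) (c : ℕ → ℝ≥0∞)
    (hc : ∀ n, OT p (μ n) (μ (n + 1)) < c n) :
    ∃ γ : Measure (ℕ → groundSpace), (∀ n, Represents γ (fun w => w n) (μ n)) ∧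
      ∀ n, (∫⁻ w, edist (w n) (w (n + 1)) ^ p ∂γ) ^ (1 / p) < c n := by
  have hp0 : 0 < p := zero_lt_one.trans_le hp
  choose π hπ hπc using fun n => exists_plan_of_OT_lt hp (hc n)
  obtain ⟨γ, h1, h2⟩ := exists_realization hp μ hμ π hπ
  exact ⟨γ, h1, fun n =>
    (ENNReal.rpow_le_rpow (h2 n) (one_div_nonneg.2 hp0.le)).trans_lt (hπc n)⟩

theorem lintegral_edist_rpow_triangle {S : Type*} [MeasurableSpace S] {γ : Measure S} {p : ℝ}
    (hp : 1 ≤ p) {X Y Z : S → groundSpace} (hX : Measurable X) (hY : Measurable Y)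
    (hZ : Measurable Z) :
    (∫⁻ s, edist (X s) (Z s) ^ p ∂γ) ^ (1 / p) ≤
      (∫⁻ s, edist (X s) (Y s) ^ p ∂γ) ^ (1 / p) + (∫⁻ s, edist (Y s) (Z s) ^ p ∂γ) ^ (1 / p) := by
  have hp0 : 0 < p := zero_lt_one.trans_le hp
  refine le_trans ?_ (ENNReal.lintegral_Lp_add_le (f := fun s => edist (X s) (Y s))
    (g := fun s => edist (Y s) (Z s)) (hX.edist hY).aemeasurable (hY.edist hZ).aemeasurable hp)
  gcongr with s
  exact edist_triangle _ _ _

theorem represents_toGround (μ : Measure upperDiag) : Represents μ toGround μ := fun A _ => by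
  rw [preimage_image_eq _ measurableEmbedding_toGround.injective]

theorem OT_self {p : ℝ} (hp : 1 ≤ p) {μ : Measure upperDiag} (hμ : persistence p μ < ∞) :
    OT p μ μ = 0 := by
  have hp0 : 0 < p := zero_lt_one.trans_le hp
  have hm := measurableEmbedding_toGround.measurable
  refine nonpos_iff_eq_zero.1 ((OT_le_of_represents hp hμ hμ hm hm
    (represents_toGround μ) (represents_toGround μ)).trans_eq ?_)
  simp [ENNReal.zero_rpow_of_pos hp0, hp0]

theorem OT_comm_le {p : ℝ} (hp : 1 ≤ p) {μ ν : Measure upperDiag}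
    (hμ : persistence p μ < ∞) (hν : persistence p ν < ∞) : OT p ν μ ≤ OT p μ ν := by
  refine le_of_forall_gt fun c hc => ?_
  obtain ⟨π, hπ, hlt⟩ := exists_plan_of_OT_lt hp hc
  refine (OT_le_of_represents hp hν hμ measurable_snd measurable_fst (represents_snd hπ)
    (represents_fst hπ)).trans_lt ?_
  simp_rw [edist_comm]
  exact hlt

theorem OT_triangle {p : ℝ} (hp : 1 ≤ p) {μ ν ξ : Measure upperDiag}
    (hμ : μ ∈ persistenceMeasures p) (hν : ν ∈ persistenceMeasures p)
    (hξ : ξ ∈ persistenceMeasures p) : OT p μ ξ ≤ OT p μ ν + OT p ν ξ := by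
  refine le_of_forall_gt fun c hc => ?_
  obtain ⟨a, ha, b, hb, hab⟩ := ENNReal.exists_add_lt_of_add_lt hc
  -- The sequence is constant from index 2 on; there any positive bound would do.
  let m : ℕ → Measure upperDiag := fun n => match n with
    | 0 => μ
    | 1 => ν
    | _ + 2 => ξ
  let d : ℕ → ℝ≥0∞ := fun n => match n with
    | 0 => a
    | 1 => b
    | _ + 2 => 1
  obtain ⟨γ, h1, h2⟩ := exists_realization_of_OT_lt hp m
    (fun n => match n with
      | 0 => hμ
      | 1 => hν
      | _ + 2 => hξ) d
    (fun n => match n with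
      | 0 => ha
      | 1 => hb
      | _ + 2 => (OT_self hp hξ.2).trans_lt zero_lt_one)
  refine (OT_le_of_represents hp hμ.2 hξ.2 (measurable_pi_apply 0) (measurable_pi_apply 2)
    (h1 0) (h1 2)).trans_lt (lt_of_le_of_lt ?_ hab)
  exact (lintegral_edist_rpow_triangle hp (measurable_pi_apply 0) (measurable_pi_apply 1)
    (measurable_pi_apply 2)).trans (add_le_add (h2 0).le (h2 1).le)

theorem persistence_add (p : ℝ) (μ ν : Measure upperDiag) :
    persistence p (μ + ν) = persistence p μ + persistence p ν :=
  lintegral_add_measure _ _ _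

/-- Leave `μ` in place and project `ρ` to the diagonal; the disjoint union of two copies of `Ω`
carries both motions. -/
theorem OT_add_left_le {p : ℝ} (hp : 1 ≤ p) {μ ρ : Measure upperDiag}
    (hμ : persistence p μ < ∞) (hρ : persistence p ρ < ∞) :
    OT p (μ + ρ) μ ≤ persistence p ρ ^ (1 / p) := by
  have hp0 : 0 < p := zero_lt_one.trans_le hp
  have hm := measurableEmbedding_toGround.measurable
  have hX : Measurable (Sum.elim toGround toGround) := hm.sumElim hm
  have hY : Measurable (Sum.elim toGround fun x => diagProj (toGround x)) :=
    hm.sumElim (measurable_diagProj.comp hm)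
  have himg : ∀ {A : Set upperDiag}, MeasurableSet A → MeasurableSet (toGround '' A) :=
    fun hA => measurableEmbedding_toGround.measurableSet_image.2 hA
  have hinj := measurableEmbedding_toGround.injective
  refine (OT_le_of_represents hp (γ := μ.map Sum.inl + ρ.map Sum.inr)
    (X := Sum.elim toGround toGround) (Y := Sum.elim toGround fun x => diagProj (toGround x))
    ?_ hμ hX hY ?_ ?_).trans ?_
  · rw [persistence_add]
    exact ENNReal.add_lt_top.2 ⟨hμ, hρ⟩
  · intro A hA
    rw [Measure.add_apply, Measure.add_apply, Measure.map_apply measurable_inl (hX (himg hA)),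
      Measure.map_apply measurable_inr (hX (himg hA)), ← preimage_comp, ← preimage_comp,
      Sum.elim_comp_inl, Sum.elim_comp_inr, preimage_image_eq _ hinj]
  · intro A hA
    rw [Measure.add_apply, Measure.map_apply measurable_inl (hY (himg hA)),
      Measure.map_apply measurable_inr (hY (himg hA)), ← preimage_comp, ← preimage_comp,
      Sum.elim_comp_inl, Sum.elim_comp_inr, preimage_image_eq _ hinj]
    have : (fun x => diagProj (toGround x)) ⁻¹' (toGround '' A) = ∅ :=
      eq_empty_of_forall_notMem fun x hx =>
        diagProj_notMem_range _ (image_subset_range _ _ hx)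
    rw [this, measure_empty, add_zero]
  · refine ENNReal.rpow_le_rpow ?_ (one_div_nonneg.2 hp0.le)
    have hf := (hX.edist hY).pow_const p
    rw [lintegral_add_measure, lintegral_map hf measurable_inl, lintegral_map hf measurable_inr]
    simp only [Sum.elim_inl, Sum.elim_inr, edist_self, ENNReal.zero_rpow_of_pos hp0,
      lintegral_zero, zero_add]
    rw [persistence_eq]
    gcongr with x
    exact edist_diagProj_le _

theorem OT_zero_right_lt_top {p : ℝ} (hp : 1 ≤ p) {μ : Measure upperDiag}
    (hμ : persistence p μ < ∞) : OT p μ 0 < ∞ := by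
  have hp0 : 0 < p := zero_lt_one.trans_le hp
  have h := OT_add_left_le hp (μ := 0) (ρ := μ) (by simp [persistence]) hμ
  rw [zero_add] at h
  exact h.trans_lt (ENNReal.rpow_lt_top_of_nonneg (one_div_nonneg.2 hp0.le) hμ.ne)

theorem zero_mem_persistenceMeasures {p : ℝ} (hp : 1 ≤ p) :
    (0 : Measure upperDiag) ∈ persistenceMeasures p :=
  (mem_persistenceMeasures_iff hp).2 (by simp [persistence])

theorem OT_lt_top {p : ℝ} (hp : 1 ≤ p) {μ ν : Measure upperDiag}
    (hμ : μ ∈ persistenceMeasures p) (hν : ν ∈ persistenceMeasures p) : OT p μ ν < ∞ :=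
  (OT_triangle hp hμ (zero_mem_persistenceMeasures hp) hν).trans_lt (ENNReal.add_lt_top.2
    ⟨OT_zero_right_lt_top hp hμ.2, (OT_comm_le hp hν.2 (by simp [persistence])).trans_lt
      (OT_zero_right_lt_top hp hν.2)⟩)

/-- Mass leaving `K` either lands in `U` or travels at least `ε`; in a plan of cost below `η * ε ^
p`, the latter mass is at most `η`. -/
theorem measure_isCompact_le_of_OT_eq_zero {p : ℝ} (hp : 1 ≤ p) {μ ν : Measure upperDiag}
    (h : OT p μ ν = 0) {K U : Set upperDiag} (hK : IsCompact K) (hU : IsOpen U) (hKU : K ⊆ U) :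
    μ K ≤ ν U := by
  have hp0 : 0 < p := zero_lt_one.trans_le hp
  obtain ⟨ε, hε, hthick⟩ := (hK.image isOpenEmbedding_toGround.continuous).exists_thickening_subset_open
    (isOpenEmbedding_toGround.isOpenMap U hU) (image_mono hKU)
  have hε0 : ENNReal.ofReal ε ^ p ≠ 0 :=
    (ENNReal.rpow_pos (ENNReal.ofReal_pos.2 hε) ENNReal.ofReal_ne_top).ne'
  have hεt : ENNReal.ofReal ε ^ p ≠ ∞ :=
    ENNReal.rpow_ne_top_of_nonneg hp0.le ENNReal.ofReal_ne_top
  refine ENNReal.le_of_forall_pos_le_add fun η hη _ => ?_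
  have hη0 : 0 < (η * ENNReal.ofReal ε ^ p : ℝ≥0∞) ^ (1 / p) := by
    refine ENNReal.rpow_pos ?_ (ENNReal.mul_ne_top ENNReal.coe_ne_top hεt)
    exact ENNReal.mul_pos (by simpa using hη.ne') hε0
  obtain ⟨π, hπ, hlt⟩ := exists_plan_of_OT_lt hp (h.trans_lt hη0)
  rw [ENNReal.rpow_lt_rpow_iff (one_div_pos.2 hp0)] at hlt
  have hm : Measurable fun z : groundSpace × groundSpace => edist z.1 z.2 ^ p :=
    (measurable_fst.edist measurable_snd).pow_const p
  rw [← represents_fst hπ K hK.measurableSet, ← represents_snd hπ U hU.measurableSet]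
  have hsub : Prod.fst ⁻¹' (toGround '' K) ⊆ Prod.snd ⁻¹' (toGround '' U) ∪
      {z : groundSpace × groundSpace | ENNReal.ofReal ε ^ p ≤ edist z.1 z.2 ^ p} := by
    intro z hz
    by_cases hd : ENNReal.ofReal ε ≤ edist z.1 z.2
    · exact Or.inr (ENNReal.rpow_le_rpow hd hp0.le)
    · refine Or.inl (hthick (Metric.mem_thickening_iff.2 ⟨z.1, hz, ?_⟩))
      rw [not_le, edist_comm, edist_dist] at hd
      exact (ENNReal.ofReal_lt_ofReal_iff hε).1 hd
  refine (measure_mono hsub).trans ((measure_union_le _ _).trans (add_le_add le_rfl ?_))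
  refine (meas_ge_le_lintegral_div hm.aemeasurable hε0 hεt).trans ?_
  exact ENNReal.div_le_of_le_mul hlt.le

theorem measure_le_of_OT_eq_zero {p : ℝ} (hp : 1 ≤ p) {μ ν : Measure upperDiag}
    (hμ : μ ∈ persistenceMeasures p) (hν : ν ∈ persistenceMeasures p) (h : OT p μ ν = 0) :
    μ ≤ ν := by
  have := hμ.1
  have := hν.1
  refine Measure.le_iff.2 fun A hA => ?_
  rw [hA.measure_eq_iSup_isCompact μ]
  refine iSup₂_le fun K hKA => iSup_le fun hK => le_trans ?_ (measure_mono hKA)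
  rw [K.measure_eq_iInf_isOpen ν]
  exact le_iInf₂ fun U hKU => le_iInf fun hU =>
    measure_isCompact_le_of_OT_eq_zero hp h hK hU hKU

theorem eq_of_OT_eq_zero {p : ℝ} (hp : 1 ≤ p) {μ ν : Measure upperDiag}
    (hμ : μ ∈ persistenceMeasures p) (hν : ν ∈ persistenceMeasures p) (h : OT p μ ν = 0) :
    μ = ν :=
  le_antisymm (measure_le_of_OT_eq_zero hp hμ hν h) (measure_le_of_OT_eq_zero hp hν hμ
    (nonpos_iff_eq_zero.1 ((OT_comm_le hp hμ.2 hν.2).trans_eq h)))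

/-! ### Completeness. -/

theorem exists_limit_of_OT_lt {p : ℝ} (hp : 1 ≤ p) (μ : ℕ → Measure upperDiag)
    (hμ : ∀ n, μ n ∈ persistenceMeasures p)
    (hc : ∀ n, OT p (μ n) (μ (n + 1)) < 2⁻¹ ^ n) :
    ∃ ξ ∈ persistenceMeasures p, Tendsto (fun n => OT p (μ n) ξ) atTop (𝓝 0) := by
  have hp0 : 0 < p := zero_lt_one.trans_le hp
  have hp1 : 0 ≤ 1 / p := one_div_nonneg.2 hp0.le
  obtain ⟨γ, hrep, hstep⟩ := exists_realization_of_OT_lt hp μ hμ _ hc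
  have hmeas : ∀ n, Measurable fun w : ℕ → groundSpace => w n := measurable_pi_apply
  have htwo : ∀ n, (2⁻¹ : ℝ≥0∞) ^ n = 2 * 2⁻¹ ^ (n + 1) := fun n => by
    rw [pow_succ', ← mul_assoc, ENNReal.mul_inv_cancel two_ne_zero ENNReal.ofNat_ne_top, one_mul]
  have hpow : ∀ n, (2⁻¹ : ℝ≥0∞) ^ n ≠ ∞ := fun n => ENNReal.pow_ne_top (by simp)
  have hpow0 : ∀ n, (2⁻¹ : ℝ≥0∞) ^ n ≠ 0 := fun n => pow_ne_zero _ (by simp)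
  set D : ℕ → ℕ → ℝ≥0∞ := fun n m => (∫⁻ w, edist (w n) (w m) ^ p ∂γ) ^ (1 / p) with hD
  have hDcomm : ∀ n m, D n m = D m n := fun n m => by simp only [hD, edist_comm]
  -- The added term is the sum of the step bounds still to come; it keeps the induction exact.
  have hDadd : ∀ n j, D n (n + j) + 2 * 2⁻¹ ^ (n + j) ≤ 2 * 2⁻¹ ^ n := by
    intro n j
    induction j with
    | zero => simp [hD, ENNReal.zero_rpow_of_pos hp0, hp0]
    | succ j ih =>
      refine le_trans ?_ ih
      calc D n (n + (j + 1)) + 2 * 2⁻¹ ^ (n + (j + 1))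
          ≤ (D n (n + j) + D (n + j) (n + j + 1)) + 2 * 2⁻¹ ^ (n + (j + 1)) := by
            gcongr
            exact lintegral_edist_rpow_triangle hp (hmeas _) (hmeas _) (hmeas _)
        _ ≤ (D n (n + j) + 2⁻¹ ^ (n + j)) + 2⁻¹ ^ (n + j) := by
            gcongr
            · exact (hstep _).le
            · exact (htwo (n + j)).ge
        _ = D n (n + j) + 2 * 2⁻¹ ^ (n + j) := by rw [add_assoc, two_mul]
  have hDle : ∀ n m, n ≤ m → D n m ≤ 2 * 2⁻¹ ^ n := fun n m h => by
    obtain ⟨j, rfl⟩ := Nat.exists_eq_add_of_le h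
    exact le_self_add.trans (hDadd n j)
  have hanti : ∀ N n : ℕ, N ≤ n → (2⁻¹ : ℝ≥0∞) ^ n ≤ 2⁻¹ ^ N := fun N n h =>
    pow_le_pow_right_of_le_one' (by simp) h
  -- The constant 3 in place of 2 gives the strict inequality needed for almost everywhere
  -- convergence.
  have hcau : ∀ N n m : ℕ, N ≤ n → N ≤ m → D n m < 3 * 2⁻¹ ^ N := by
    intro N n m hn hm
    have h23 : (2 : ℝ≥0∞) * 2⁻¹ ^ N < 3 * 2⁻¹ ^ N :=
      (ENNReal.mul_lt_mul_iff_left (hpow0 N) (hpow N)).2 (by norm_num)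
    refine lt_of_le_of_lt ?_ h23
    rcases le_total n m with h | h
    · exact (hDle n m h).trans (by gcongr 2 * ?_; exact hanti _ _ hn)
    · exact (hDcomm n m).trans_le ((hDle m n h).trans (by gcongr 2 * ?_; exact hanti _ _ hm))
  have hlimP : ∀ᵐ w ∂γ, ∃ l : Plane, Tendsto (fun n => ((w n : groundSpace) : Plane)) atTop (𝓝 l) := by
    refine Lp.ae_tendsto_of_cauchy_eLpNorm' (f := fun n (w : ℕ → groundSpace) => (w n : Plane))
      (fun n => (measurable_subtype_coe.comp (hmeas n)).aestronglyMeasurable) hp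
      (B := fun n => 3 * 2⁻¹ ^ n) ?_ fun N n m hn hm => ?_
    · rw [ENNReal.tsum_mul_left, ENNReal.tsum_geometric]
      simp [ENNReal.mul_eq_top]
    · refine lt_of_eq_of_lt ?_ (hcau N n m hn hm)
      simp only [eLpNorm', hD, Pi.sub_apply, Subtype.edist_eq, edist_eq_enorm_sub]
  have hlim : ∀ᵐ w ∂γ, ∃ l : groundSpace, Tendsto (fun n => w n) atTop (𝓝 l) := by
    filter_upwards [hlimP] with w ⟨l, hl⟩
    exact ⟨⟨l, isClosed_groundSpace.mem_of_tendsto hl (Eventually.of_forall fun n => (w n).2)⟩,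
      tendsto_subtype_rng.2 hl⟩
  obtain ⟨L, hL, hLlim⟩ := measurable_limit_of_tendsto_metrizable_ae
    (fun n => (hmeas n).aemeasurable) hlim
  -- Fatou's lemma, letting `m` tend to infinity in `hDle`.
  have hfatou : ∀ n, (∫⁻ w, edist (w n) (L w) ^ p ∂γ) ^ (1 / p) ≤ 2 * 2⁻¹ ^ n := by
    intro n
    rw [one_div, ENNReal.rpow_inv_le_iff hp0]
    calc ∫⁻ w, edist (w n) (L w) ^ p ∂γ
        = ∫⁻ w, liminf (fun m => edist (w n) (w m) ^ p) atTop ∂γ := by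
          refine lintegral_congr_ae ?_
          filter_upwards [hLlim] with w hw
          refine (Tendsto.liminf_eq ?_).symm
          exact (ENNReal.continuous_rpow_const.tendsto _).comp (tendsto_const_nhds.edist hw)
      _ ≤ liminf (fun m => ∫⁻ w, edist (w n) (w m) ^ p ∂γ) atTop :=
          lintegral_liminf_le fun m => ((hmeas n).edist (hmeas m)).pow_const p
      _ ≤ (2 * 2⁻¹ ^ n) ^ p := by
          refine liminf_le_of_frequently_le' (Eventually.frequently ?_)
          filter_upwards [eventually_ge_atTop n] with m hm
          have := hDle n m hm
          simp only [hD] at this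
          rwa [one_div, ENNReal.rpow_inv_le_iff hp0] at this
  have hLrep := represents_comap (γ := γ) hL
  have hξ : persistence p ((γ.map L).comap toGround) < ∞ := by
    have h := persistence_rpow_le hp (hmeas 0) hL (hrep 0) hLrep
    refine lt_top_iff_ne_top.2 fun htop => ?_
    rw [htop, ENNReal.top_rpow_of_pos (one_div_pos.2 hp0), top_le_iff, ENNReal.add_eq_top] at h
    rcases h with h | h
    · exact ENNReal.rpow_ne_top_of_nonneg hp1 (hμ 0).2.ne h
    · exact ((hfatou 0).trans_lt (ENNReal.mul_lt_top ENNReal.ofNat_lt_top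
        (hpow 0).lt_top)).ne h
  refine ⟨_, (mem_persistenceMeasures_iff hp).2 hξ, ?_⟩
  have h0 : Tendsto (fun n => (2 : ℝ≥0∞) * 2⁻¹ ^ n) atTop (𝓝 0) := by
    have := ENNReal.Tendsto.const_mul (a := 2) (ENNReal.tendsto_pow_atTop_nhds_zero_of_lt_one
      (r := 2⁻¹) (by simp)) (Or.inr ENNReal.ofNat_ne_top)
    rwa [mul_zero] at this
  exact tendsto_of_tendsto_of_tendsto_of_le_of_le tendsto_const_nhds h0 (fun n => zero_le)
    fun n => (OT_le_of_represents hp (hμ n).2 hξ (hmeas n) hL (hrep n) hLrep).trans (hfatou n)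

/-! ### Separability. -/

instance : Nonempty upperDiag := ⟨⟨!₂[0, 1], by simp [upperDiag]⟩⟩

/-- The measure with atoms of rational masses `f i` at a dense sequence of points. -/
noncomputable def rationalAtoms (f : ℕ →₀ ℚ) : Measure upperDiag :=
  Measure.sum fun i => ((Real.toNNReal (f i) : NNReal) : ℝ≥0∞) •
    Measure.dirac (TopologicalSpace.denseSeq upperDiag i)

theorem persistence_sum_smul_dirac (p : ℝ) (a : ℕ → ℝ≥0∞) (e : ℕ → upperDiag) :
    persistence p (Measure.sum fun i => a i • Measure.dirac (e i)) =
      ∑' i, a i * diagDist (toGround (e i)) ^ p := by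
  rw [persistence_eq, lintegral_sum_measure]
  simp_rw [lintegral_smul_measure, lintegral_dirac, smul_eq_mul]

theorem exists_rat_toNNReal_le {a δ : ℝ≥0∞} (ha : a ≠ ∞) (hδ : δ ≠ 0) :
    ∃ q : ℚ, ((Real.toNNReal q : NNReal) : ℝ≥0∞) ≤ a ∧
      a - ((Real.toNNReal q : NNReal) : ℝ≥0∞) ≤ δ := by
  by_cases h0 : a = 0
  · exact ⟨0, by simp, by simp [h0]⟩
  · obtain ⟨q, -, hq1, hq2⟩ := ENNReal.lt_iff_exists_rat_btwn.1 (ENNReal.sub_lt_self ha h0 hδ)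
    exact ⟨q, hq2.le, tsub_le_iff_tsub_le.1 hq1.le⟩

/-- Outside a finite set the weighted sum is below `θ / 2`; inside it, rounding `a i` down by at
most `δ i / c i` costs at most `δ i`, with total below `θ / 2`. -/
theorem exists_finsupp_tsum_lt {a c : ℕ → ℝ≥0∞} (hc0 : ∀ i, c i ≠ 0) (hc : ∀ i, c i ≠ ∞)
    (hac : ∑' i, a i * c i ≠ ∞) {θ : ℝ≥0∞} (hθ : θ ≠ 0) :
    ∃ f : ℕ →₀ ℚ, (∀ i, ((Real.toNNReal (f i) : NNReal) : ℝ≥0∞) ≤ a i) ∧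
      ∑' i, (a i - ((Real.toNNReal (f i) : NNReal) : ℝ≥0∞)) * c i < θ := by
  have ha : ∀ i, a i ≠ ∞ := fun i h => by
    refine hac (ENNReal.tsum_eq_top_of_eq_top ⟨i, ?_⟩)
    rw [h, ENNReal.top_mul (hc0 i)]
  have hθ2 : θ / 2 ≠ 0 := (ENNReal.half_pos hθ).ne'
  obtain ⟨δ, hδ0, hδ⟩ := ENNReal.exists_pos_sum_of_countable hθ2 ℕ
  choose q hq1 hq2 using fun i => exists_rat_toNNReal_le (ha i)
    (δ := δ i / c i) (ENNReal.div_pos (by simpa using (hδ0 i).ne') (hc i)).ne'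
  obtain ⟨s, hs⟩ := ((ENNReal.tendsto_tsum_compl_atTop_zero hac).eventually
    (gt_mem_nhds (ENNReal.half_pos hθ))).exists
  have htail : ∑' i, (if i ∈ s then 0 else a i * c i) < θ / 2 := by
    refine lt_of_eq_of_lt ?_ hs
    refine Eq.trans (tsum_congr fun i => ?_) (tsum_subtype {x | x ∉ s} fun i => a i * c i).symm
    by_cases h : i ∈ s <;> simp [h]
  refine ⟨Finsupp.onFinset s (fun i => if i ∈ s then q i else 0) fun i hi => by
    by_contra h; simp [h] at hi, fun i => ?_, ?_⟩
  · rw [Finsupp.onFinset_apply]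
    split_ifs
    · exact hq1 i
    · simp
  · refine lt_of_le_of_lt ?_ ((ENNReal.add_lt_add hδ htail).trans_eq (ENNReal.add_halves θ))
    rw [← ENNReal.tsum_add]
    refine ENNReal.tsum_le_tsum fun i => ?_
    rw [Finsupp.onFinset_apply]
    split_ifs
    · rw [add_zero]
      calc _ ≤ (δ i / c i) * c i := by gcongr; exact hq2 i
        _ = δ i := ENNReal.div_mul_cancel (hc0 i) (hc i)
    · simp

theorem exists_rationalAtoms_near {p : ℝ} (hp : 1 ≤ p) {μ : Measure upperDiag}
    (hμ : μ ∈ persistenceMeasures p) {η : ℝ≥0∞} (hη : η ≠ 0) (hηt : η ≠ ∞) :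
    ∃ f : ℕ →₀ ℚ, rationalAtoms f ∈ persistenceMeasures p ∧ OT p μ (rationalAtoms f) < η := by
  classical
  have hp0 : 0 < p := zero_lt_one.trans_le hp
  have hp1 : 0 < 1 / p := one_div_pos.2 hp0
  have hm := measurableEmbedding_toGround.measurable
  set e := TopologicalSpace.denseSeq upperDiag with he
  have hη2 : η / 2 ≠ 0 := (ENNReal.half_pos hη).ne'
  obtain ⟨ε, hε0, hε⟩ := ENNReal.exists_nnreal_pos_mul_lt
    (ENNReal.rpow_ne_top_of_nonneg hp1.le hμ.2.ne) hη2
  -- A relative error makes the cost of the displacement at most `ε ^ p` times the persistence, even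
  -- when `μ` has infinite mass near the diagonal.
  have hex : ∀ x : upperDiag, ∃ i, edist x (e i) < ε * diagDist (toGround x) := fun x =>  by
    have hpos : 0 < (ε : ℝ≥0∞) * diagDist (toGround x) :=
      ENNReal.mul_pos (by simpa using hε0.ne') (diagDist_toGround_pos x).ne'
    obtain ⟨_, ⟨i, rfl⟩, hi⟩ := EMetric.mem_closure_iff.1
      (TopologicalSpace.denseRange_denseSeq upperDiag x) _ hpos
    exact ⟨i, hi⟩
  let N : upperDiag → ℕ := fun x => Nat.find (hex x)
  have hN : Measurable N := measurable_find hex fun i =>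
    measurableSet_lt (measurable_id.edist measurable_const)
      ((measurable_diagDist.comp hm).const_mul _)
  have hT : Measurable fun x => e (N x) := (measurable_from_nat (f := e)).comp hN
  have hY : Measurable fun x => toGround (e (N x)) := hm.comp hT
  have hmap : μ.map (fun x => e (N x)) =
      Measure.sum fun i => (μ.map N {i}) • Measure.dirac (e i) := by
    ext A hA
    have h1 : μ.map (fun x => e (N x)) A = ∫⁻ i, A.indicator 1 (e i) ∂(μ.map N) := by
      rw [lintegral_map (measurable_from_nat) hN, ← lintegral_indicator_one hA,
        lintegral_map (measurable_one.indicator hA) hT]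
    rw [h1, lintegral_countable', Measure.sum_apply _ hA]
    refine tsum_congr fun i => ?_
    rw [Measure.smul_apply, Measure.dirac_apply' _ hA, smul_eq_mul, mul_comm]
  set ν := μ.map (fun x => e (N x)) with hν
  have hrep : Represents μ (fun x => toGround (e (N x))) ν := fun A hA => by
    rw [hν, Measure.map_apply hT hA]
    congr 1
    ext x
    simp [measurableEmbedding_toGround.injective.mem_set_image]
  have hcost : (∫⁻ x, edist (toGround x) (toGround (e (N x))) ^ p ∂μ) ^ (1 / p) < η / 2 := by
    refine lt_of_le_of_lt ?_ hε
    calc (∫⁻ x, edist (toGround x) (toGround (e (N x))) ^ p ∂μ) ^ (1 / p)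
        ≤ (∫⁻ x, (ε : ℝ≥0∞) ^ p * diagDist (toGround x) ^ p ∂μ) ^ (1 / p) := by
          gcongr with x
          rw [← ENNReal.mul_rpow_of_nonneg _ _ hp0.le]
          exact ENNReal.rpow_le_rpow (Nat.find_spec (hex x)).le hp0.le
      _ = ε * persistence p μ ^ (1 / p) := by
          have hd : Measurable fun x => diagDist (toGround x) ^ p :=
            (measurable_diagDist.comp hm).pow_const p
          rw [lintegral_const_mul _ hd,
            ENNReal.mul_rpow_of_nonneg _ _ hp1.le, ← ENNReal.rpow_mul, mul_one_div_cancel hp0.ne',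
            ENNReal.rpow_one, persistence_eq]
  have hνfin : persistence p ν < ∞ := by
    have h := persistence_rpow_le hp hm hY (represents_toGround μ) hrep
    refine lt_top_iff_ne_top.2 fun htop => ?_
    rw [htop, ENNReal.top_rpow_of_pos hp1, top_le_iff, ENNReal.add_eq_top] at h
    rcases h with h | h
    · exact ENNReal.rpow_ne_top_of_nonneg hp1.le hμ.2.ne h
    · exact (hcost.trans_le le_top).ne h
  have hOT1 : OT p μ ν < η / 2 :=
    (OT_le_of_represents hp hμ.2 hνfin hm hY (represents_toGround μ) hrep).trans_lt hcost
  have hθ : (η / 2) ^ p ≠ 0 :=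
    (ENNReal.rpow_pos (ENNReal.half_pos hη) (ENNReal.div_ne_top hηt two_ne_zero)).ne'
  obtain ⟨f, hf1, hf2⟩ := exists_finsupp_tsum_lt (a := fun i => μ.map N {i})
    (c := fun i => diagDist (toGround (e i)) ^ p)
    (fun i => (ENNReal.rpow_pos (diagDist_toGround_pos _) (diagDist_ne_top _)).ne')
    (fun i => ENNReal.rpow_ne_top_of_nonneg hp0.le (diagDist_ne_top _))
    (by rw [← persistence_sum_smul_dirac, ← hmap]; exact hνfin.ne) hθ
  set ρ : Measure upperDiag := Measure.sum fun i =>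
    (μ.map N {i} - ((Real.toNNReal (f i) : NNReal) : ℝ≥0∞)) • Measure.dirac (e i) with hρ
  -- Rounding down leaves a positive surplus `ρ` of small persistence, which `OT_add_left_le`
  -- removes.
  have hsplit : ν = rationalAtoms f + ρ := by
    rw [hmap, rationalAtoms, hρ, Measure.sum_add_sum]
    congr 1
    ext1 i
    rw [← he, ← add_smul, add_tsub_cancel_of_le (hf1 i)]
  have hρθ : persistence p ρ < (η / 2) ^ p := by
    rw [hρ, persistence_sum_smul_dirac]
    exact hf2
  rw [hsplit, persistence_add, ENNReal.add_lt_top] at hνfin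
  have hmem := (mem_persistenceMeasures_iff hp).2 hνfin.1
  refine ⟨f, hmem, ?_⟩
  have hOT2 : OT p ν (rationalAtoms f) < η / 2 := by
    rw [hsplit]
    refine (OT_add_left_le hp hνfin.1 hνfin.2).trans_lt ?_
    rwa [one_div, ENNReal.rpow_inv_lt_iff hp0]
  have hνmem : ν ∈ persistenceMeasures p := by
    rw [mem_persistenceMeasures_iff hp, hsplit, persistence_add]
    exact ENNReal.add_lt_top.2 hνfin
  exact (OT_triangle hp hμ hνmem hmem).trans_lt
    ((ENNReal.add_lt_add hOT1 hOT2).trans_eq (ENNReal.add_halves η))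

/-! ### The metric space. -/

/-- The metric `OT_p` on `M^p`. -/
noncomputable abbrev otMetricSpace {p : ℝ} (hp : 1 ≤ p) : MetricSpace (persistenceMeasures p) where
  dist μ ν := (OT p μ.1 ν.1).toReal
  edist μ ν := OT p μ.1 ν.1
  edist_dist μ ν := (ENNReal.ofReal_toReal (OT_lt_top hp μ.2 ν.2).ne).symm
  dist_self μ := by simp [OT_self hp μ.2.2]
  dist_comm μ ν := by
    rw [le_antisymm (OT_comm_le hp ν.2.2 μ.2.2) (OT_comm_le hp μ.2.2 ν.2.2)]
  dist_triangle μ ν ξ := by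
    rw [← ENNReal.toReal_add (OT_lt_top hp μ.2 ν.2).ne (OT_lt_top hp ν.2 ξ.2).ne]
    exact ENNReal.toReal_mono (ENNReal.add_ne_top.2
      ⟨(OT_lt_top hp μ.2 ν.2).ne, (OT_lt_top hp ν.2 ξ.2).ne⟩) (OT_triangle hp μ.2 ν.2 ξ.2)
  eq_of_dist_eq_zero {μ ν} h := Subtype.ext (eq_of_OT_eq_zero hp μ.2 ν.2
    (((ENNReal.toReal_eq_zero_iff _).1 h).resolve_right (OT_lt_top hp μ.2 ν.2).ne))

theorem mainTheorem8 (p : ℝ) (hp : 1 ≤ p) :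
    ∃ _ : MetricSpace (persistenceMeasures p),
      (∀ μ ν : persistenceMeasures p, edist μ ν = OT p μ.1 ν.1) ∧
      CompleteSpace (persistenceMeasures p) ∧
      TopologicalSpace.SeparableSpace (persistenceMeasures p) ∧
      PolishSpace (persistenceMeasures p) := by
  let _ := otMetricSpace hp
  have hedist : ∀ μ ν : persistenceMeasures p, edist μ ν = OT p μ.1 ν.1 := fun _ _ => rfl
  have hcomplete : CompleteSpace (persistenceMeasures p) := by
    -- Sequences with geometrically controlled distances suffice for completeness.
    refine EMetric.complete_of_convergent_controlled_sequences (fun n => 2⁻¹ ^ n)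
      (fun n => pos_iff_ne_zero.2 (pow_ne_zero _ (by simp))) fun u hu => ?_
    obtain ⟨ξ, hξ, hlim⟩ := exists_limit_of_OT_lt hp (fun n => (u n).1) (fun n => (u n).2)
      fun n => hu n n (n + 1) le_rfl n.le_succ
    exact ⟨⟨ξ, hξ⟩, tendsto_iff_edist_tendsto_0.2 hlim⟩
  have hsep : TopologicalSpace.SeparableSpace (persistenceMeasures p) := by
    refine ⟨⟨{μ | ∃ f, rationalAtoms f = μ.1},
      ((countable_range rationalAtoms).preimage Subtype.val_injective), fun μ => ?_⟩⟩
    refine EMetric.mem_closure_iff.2 fun ε hε => ?_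
    -- The radius `ε` may be infinite; `min ε 1` is not.
    obtain ⟨f, hf, hlt⟩ := exists_rationalAtoms_near hp μ.2
      (lt_min hε zero_lt_one).ne' (min_lt_of_right_lt ENNReal.one_lt_top).ne
    exact ⟨⟨rationalAtoms f, hf⟩, ⟨f, rfl⟩, hlt.trans_le (min_le_left _ _)⟩
  refine ⟨inferInstance, hedist, hcomplete, hsep, ?_⟩
  have : SecondCountableTopology (persistenceMeasures p) :=
    UniformSpace.secondCountable_of_separable _
  infer_instance
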